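/- There are universal constants $C$ and $D$, and one can take $D=4$ and $C=570$, such that the following holds. Let $X$ be a random variable with values in $\mathbb{Z}$ and law $\mu$, and let $\lambda,\tau>0$ be real numbers. Assume that there are complex coefficients $(b_s)_{s\geq 2}$ such that for every $\xi\in\mathbb{R}$, $$\mathbb{E}[\mathrm{e}^{\mathrm{i}\xi X}]\,\mathrm{e}^{-\lambda(\mathrm{e}^{\mathrm{i}\xi}-1)} = 1+\sum_{s=2}^\infty b_s\,(\mathrm{e}^{\mathrm{i}\xi}-1)^s,\qquad\text{with } |b_s|\leq\left(\frac{\tau}{\sqrt{s}}\right)^{s}\text{ for all } s\geq 2.$$ For an integer $r\geq 1$, let $\nu^{(r)}$, the approximation scheme of order $r$ of $\mu$, be the finite signed measure on $\mathbb{Z}$ whose Fourier transform $\widehat{\nu}^{(r)}(\xi)=\sum_{k\in\mathbb{Z}}\nu^{(r)}(k)\,\mathrm{e}^{\mathrm{i}k\xi}$ is given by $$\widehat{\nu}^{(r)}(\xi)\,\mathrm{e}^{-\lambda(\mathrm{e}^{\mathrm{i}\xi}-1)} = 1+\sum_{s=2}^r b_s\,(\mathrm{e}^{\mathrm{i}\xi}-1)^s\qquad(\xi\in\mathbb{R});$$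 this signed measure exists and is unique. Let $d_{\mathrm{TV}}(\mu,\nu)=\frac12\sum_{k\in\mathbb{Z}}|\mu(k)-\nu(k)|$. If $\varepsilon=\frac{D\tau}{\sqrt{\lambda}}<1$, then for every $r\geq 1$, $$d_{\mathrm{TV}}(\mu,\nu^{(r)})\leq C\,\varepsilon^{r+1}.$$ -/

import Mathlib

open MeasureTheory

namespace ModPoisson

/-- The Poisson deconvolution residue `ψ(ξ) = E[e^{iξX}] e^{-λ(e^{iξ}-1)}` of an integer-valued
random variable `X`. -/
noncomputable def residue {Ω : Type*} [MeasurableSpace Ω] (P : Measure Ω) (X : Ω → ℤ)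
    (lam : ℝ) (ξ : ℝ) : ℂ :=
  (∫ ω, Complex.exp (Complex.I * ξ * (X ω : ℂ)) ∂P) *
    Complex.exp (-(lam : ℂ) * (Complex.exp (Complex.I * ξ) - 1))

/-- The point masses of a finite signed measure on `ℤ` are (absolutely) summable, so the series
in the two definitions below converge for all signed measures. -/
theorem summable_abs_mass (ν : SignedMeasure ℤ) : Summable fun k : ℤ => |ν {k}| :=
  (ν.hasSum_of_disjoint_iUnion (f := fun k : ℤ => {k}) (fun k => measurableSet_singleton k)
    (fun i j h => by simpa [Function.onFun] using h)).summable.abs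

/-- Fourier transform `∑ₖ ν(k) e^{ikξ}` of a signed measure on `ℤ`. -/
noncomputable def fourierTransform (ν : SignedMeasure ℤ) (ξ : ℝ) : ℂ :=
  ∑' k : ℤ, ((ν {k} : ℝ) : ℂ) * Complex.exp (Complex.I * ξ * (k : ℂ))

/-- Total variation distance `½ ∑ₖ |μ(k) - ν(k)|` of two signed measures on `ℤ`. -/
noncomputable def dTV (μ ν : SignedMeasure ℤ) : ℝ :=
  (1 / 2) * ∑' k : ℤ, |μ {k} - ν {k}|

/-- `ν` is the approximation scheme of order `r` with parameter `λ` and residue coefficients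
`b₂, b₃, …`: its deconvolution residue is the residue series truncated at degree `r`. -/
def IsApproximationScheme (lam : ℝ) (b : ℕ → ℂ) (r : ℕ) (ν : SignedMeasure ℤ) : Prop :=
  ∀ ξ : ℝ,
    fourierTransform ν ξ * Complex.exp (-(lam : ℂ) * (Complex.exp (Complex.I * ξ) - 1)) =
      1 + ∑ s ∈ Finset.Icc 2 r, b s * (Complex.exp (Complex.I * ξ) - 1) ^ s

end ModPoisson

namespace ModPoisson

open Filter Topology

/-! Let `S` be translation by one on `ℓ¹(ℤ)`. The Fourier transform turns `S` into multiplication by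
`e^{iξ}`, so the hypothesis says that `μ` is the sum of `b_s (S - 1)^s exp(λ(S - 1)) δ₀` (with
leading term `1`), and `μ - ν` is the tail `s > r` of this `ℓ¹` series. Writing `exp(λ(S - 1))` as
an `s`-th power, and using `‖(S - 1) exp(t(S - 1))‖ ≤ 1/√t` with `t = λ/s`, bounds each difference
by `(√s/√λ)^s` (`norm_sub_one_pow_mul_exp_le`). The factor `√s^s` cancels against the bound on
`b_s`, leaving a geometric tail of ratio `τ/√λ = ε/4`.

For `ν` to be a real measure the `b_s` must be real (`coeff_real`): this follows from the symmetry
of `ψ` and uniqueness of power series in `e^{iξ} - 1`. -/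

theorem hasSum_of_eq {ι E : Type*} [AddCommMonoid E] [TopologicalSpace E] {f g : ι → E} {a b : E}
    (h : HasSum f a) (hfg : ∀ i, g i = f i) (hab : b = a) : HasSum g b := by
  rw [hab, funext hfg]
  exact h

/-! ### Uniqueness and reality of the residue coefficients. -/

section PowerSeries

/-- Points `e^{iξ} - 1` accumulate at `0`. -/
theorem frequently_mem_range_exp_sub_one :
    ∃ᶠ w in 𝓝[≠] (0 : ℂ), ∃ ξ : ℝ, Complex.exp (Complex.I * ξ) - 1 = w := by
  have hlim : Tendsto (fun ξ : ℝ => Complex.exp (Complex.I * ξ) - 1) (𝓝[>] 0) (𝓝[≠] 0) := by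
    rw [tendsto_nhdsWithin_iff]
    constructor
    · have : Continuous fun ξ : ℝ => Complex.exp (Complex.I * ξ) - 1 := by fun_prop
      simpa using (this.tendsto 0).mono_left nhdsWithin_le_nhds
    · filter_upwards [Ioo_mem_nhdsGT Real.pi_pos] with ξ hξ h
      have h2 := congrArg Complex.im h
      rw [mul_comm, Complex.sub_im, Complex.exp_ofReal_mul_I_im] at h2
      simp only [Complex.one_im, sub_zero, Complex.zero_im] at h2
      exact (Real.sin_pos_of_pos_of_lt_pi hξ.1 hξ.2).ne' h2
  exact hlim.frequently (Frequently.of_forall fun ξ => ⟨ξ, rfl⟩)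

/-- A power series in `e^{iξ} - 1` which vanishes for all real `ξ` has zero coefficients. -/
theorem coeff_eq_zero_of_hasSum_zero (c : ℕ → ℂ)
    (h : ∀ ξ : ℝ, HasSum (fun n : ℕ => c n * (Complex.exp (Complex.I * ξ) - 1) ^ (n + 2)) 0) :
    c = 0 := by
  set p := FormalMultilinearSeries.ofScalars ℂ c with hp
  have hrad : ((2 : NNReal) : ENNReal) ≤ p.radius := by
    apply p.le_radius_of_tendsto (l := 0)
    -- At `ξ = π` the base is `-2`, so `|c n| 2^(n+2)` tends to `0`; dividing by `4` removes the
    -- shift of the exponent.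
    have h1 := (h Real.pi).summable.tendsto_atTop_zero.norm.div_const 4
    simp only [norm_zero, zero_div] at h1
    refine h1.congr fun n => ?_
    have : Complex.exp (Complex.I * (Real.pi : ℝ)) = -1 := by
      rw [mul_comm, Complex.exp_pi_mul_I]
    rw [this, hp, FormalMultilinearSeries.ofScalars_norm]
    norm_num [pow_add]
    ring
  have hpos : 0 < p.radius := lt_of_lt_of_le (by norm_num) hrad
  have hps : HasFPowerSeriesAt p.sum p 0 := (p.hasFPowerSeriesOnBall hpos).hasFPowerSeriesAt
  have hfreq : ∃ᶠ w in 𝓝[≠] (0 : ℂ), p.sum w = 0 := by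
    refine (frequently_mem_range_exp_sub_one.and_eventually
      (self_mem_nhdsWithin : {0}ᶜ ∈ 𝓝[≠] (0 : ℂ))).mono ?_
    rintro w ⟨⟨ξ, rfl⟩, hw⟩
    have h1 := (h ξ).div_const ((Complex.exp (Complex.I * ξ) - 1) ^ 2)
    have hw2 : (Complex.exp (Complex.I * ξ) - 1) ^ 2 ≠ 0 := pow_ne_zero _ hw
    simp only [pow_add, ← mul_assoc, mul_div_cancel_right₀ _ hw2, zero_div] at h1
    rw [← h1.tsum_eq, hp]
    exact FormalMultilinearSeries.ofScalars_sum_eq c _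
  have hev := hps.analyticAt.frequently_zero_iff_eventually_zero.1 hfreq
  exact (FormalMultilinearSeries.ofScalars_series_eq_zero ℂ).1 (hps.eq_zero_of_eventually hev)

theorem residue_neg {Ω : Type*} [MeasurableSpace Ω] (P : Measure Ω) (X : Ω → ℤ) (lam ξ : ℝ) :
    residue P X lam (-ξ) = (starRingEnd ℂ) (residue P X lam ξ) := by
  simp only [residue, map_mul, ← integral_conj, ← Complex.exp_conj, map_sub, map_neg, map_one,
    Complex.conj_ofReal, Complex.conj_I, map_intCast, Complex.ofReal_neg, mul_neg, neg_mul]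

/-- The coefficients of the residue series are real. -/
theorem coeff_real {Ω : Type*} [MeasurableSpace Ω] (P : Measure Ω) (X : Ω → ℤ) (lam : ℝ)
    (b : ℕ → ℂ)
    (hψ : ∀ ξ : ℝ, HasSum
      (fun s : ℕ => b (s + 2) * (Complex.exp (Complex.I * ξ) - 1) ^ (s + 2))
      (residue P X lam ξ - 1)) (s : ℕ) (hs : 2 ≤ s) :
    ((b s).re : ℂ) = b s := by
  have h0 := coeff_eq_zero_of_hasSum_zero (fun n => b (n + 2) - (starRingEnd ℂ) (b (n + 2)))
    fun ξ => by
      -- Conjugating the series at `-ξ` gives a series for the same residue at `ξ`, with conjugate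
      -- coefficients.
      have h1 := Complex.hasSum_conj'.2 (hψ (-ξ))
      have h2 := (hψ ξ).sub h1
      rw [residue_neg] at h2
      simp only [map_sub, map_one, Complex.conj_conj, sub_self] at h2
      refine hasSum_of_eq h2 (fun n => ?_) rfl
      simp only [map_mul, map_pow, map_sub, map_one, map_neg, ← Complex.exp_conj, Complex.conj_I,
        Complex.conj_ofReal, Complex.ofReal_neg, mul_neg, neg_mul, neg_neg, sub_mul]
  have h3 := congrFun h0 (s - 2)
  simp only [Nat.sub_add_cancel hs, Pi.zero_apply, sub_eq_zero] at h3
  exact Complex.conj_eq_iff_re.1 h3.symm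

end PowerSeries

/-! ### Injectivity of Fourier series on summable families. -/

section Fourier

theorem norm_exp_I_mul_intCast (ξ : ℝ) (k : ℤ) : ‖Complex.exp (Complex.I * ξ * k)‖ = 1 := by
  rw [show Complex.I * ξ * (k : ℂ) = ((ξ * k : ℝ) : ℂ) * Complex.I by push_cast; ring,
    Complex.norm_exp_ofReal_mul_I]

/-- A summable family is determined by its Fourier series. -/
theorem eq_zero_of_fourier_series_eq_zero (a : ℤ → ℂ) (ha : Summable fun k => ‖a k‖)
    (h : ∀ ξ : ℝ, ∑' k : ℤ, a k * Complex.exp (Complex.I * ξ * k) = 0) : a = 0 := by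
  have hs : Summable fun k : ℤ => a k • (fourier k : C(UnitAddCircle, ℂ)) := by
    refine Summable.of_norm ?_
    simpa [norm_smul, fourier_norm] using ha
  have h0 : HasSum (fun k : ℤ => a k • (fourier k : C(UnitAddCircle, ℂ))) 0 := by
    convert hs.hasSum
    ext x
    induction x using QuotientAddGroup.induction_on with
    | H x =>
      have h1 := ((ContinuousMap.evalCLM ℂ (x : UnitAddCircle)).hasSum hs.hasSum).tsum_eq
      simp only [ContinuousMap.evalCLM_apply] at h1
      rw [ContinuousMap.zero_apply]
      refine Eq.trans ?_ h1
      rw [← h (2 * Real.pi * x)]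
      refine tsum_congr fun k => ?_
      rw [ContinuousMap.smul_apply, fourier_coe_apply, smul_eq_mul]
      congr 2
      push_cast
      ring
  -- The uniformly convergent series also converges in `L²`, where pairing with an orthonormal
  -- exponential isolates `a n`.
  have h1 := (ContinuousMap.toLp (E := ℂ) 2 AddCircle.haarAddCircle ℂ).hasSum h0
  funext n
  have h2 := (innerSL ℂ (fourierLp (T := 1) 2 n)).hasSum h1
  simp only [map_smul, map_zero] at h2
  have h3 := h2.unique (hasSum_single n fun k hk => by
    have := (orthonormal_fourier (T := 1)).2 hk.symm
    simp only [innerSL_apply_apply, smul_eq_mul]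
    exact mul_eq_zero_of_right _ this)
  have h4 := (orthonormal_iff_ite.1 (orthonormal_fourier (T := 1))) n n
  simp only [if_true] at h4
  simp only [innerSL_apply_apply, smul_eq_mul] at h3
  have h5 : (0 : ℂ) = a n * 1 := h3.trans (congrArg (a n * ·) h4)
  simpa using h5.symm

end Fourier

/-! ### Signed measures on `ℤ` as summable sequences. -/

section SignedMeasures

theorem signedMeasure_ext (μ ν : SignedMeasure ℤ) (h : ∀ k : ℤ, μ {k} = ν {k}) : μ = ν := by
  refine VectorMeasure.ext fun s hs => ?_
  have key (ρ : SignedMeasure ℤ) : HasSum (fun k : s => ρ {(k : ℤ)}) (ρ s) := by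
    have := ρ.hasSum_of_disjoint_iUnion (f := fun k : s => {(k : ℤ)})
      (fun k => measurableSet_singleton _) (fun i j hij => by
        simpa [Function.onFun, Subtype.ext_iff] using hij)
    simpa using this
  have hμ := key μ
  simp only [h] at hμ
  exact hμ.unique (key ν)

theorem exists_signedMeasure (a : ℤ → ℝ) (ha : Summable fun k => |a k|) :
    ∃ ν : SignedMeasure ℤ, ∀ k, ν {k} = a k := by
  have hint : Integrable a Measure.count := by
    rw [integrable_count_iff]
    exact ha
  refine ⟨Measure.count.withDensityᵥ a, fun k => ?_⟩
  rw [withDensityᵥ_apply hint (measurableSet_singleton k)]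
  simp

theorem integral_exp_eq_fourierTransform {Ω : Type*} [MeasurableSpace Ω] (P : Measure Ω)
    [IsProbabilityMeasure P] (X : Ω → ℤ) (hX : Measurable X) (ξ : ℝ) :
    ∫ ω, Complex.exp (Complex.I * ξ * (X ω : ℂ)) ∂P =
      fourierTransform (P.map X).toSignedMeasure ξ := by
  have : IsProbabilityMeasure (P.map X) := Measure.isProbabilityMeasure_map hX.aemeasurable
  have hmeas : AEStronglyMeasurable (fun k : ℤ => Complex.exp (Complex.I * ξ * (k : ℂ)))
    (P.map X) := (Measurable.of_discrete).aestronglyMeasurable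
  rw [← integral_map (φ := X) (f := fun k : ℤ => Complex.exp (Complex.I * ξ * (k : ℂ)))
    hX.aemeasurable hmeas, integral_countable]
  · refine tsum_congr fun k => ?_
    rw [Measure.toSignedMeasure_apply_measurable (measurableSet_singleton k), Complex.real_smul]
  · refine (integrable_const (1 : ℝ)).mono' hmeas (ae_of_all _ fun k => ?_)
    rw [norm_exp_I_mul_intCast]

end SignedMeasures

/-! ### Smoothing by the Poisson semigroup in a Banach algebra. -/

section Smoothing

open NormedSpace
open scoped Nat

theorem hasSum_pow_div_factorial (t : ℝ) :
    HasSum (fun k : ℕ => t ^ k / k !) (Real.exp t) := by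
  have := NormedSpace.expSeries_div_hasSum_exp t
  rwa [← Real.exp_eq_exp_ℝ] at this

theorem hasSum_mul_pow_div_factorial (t : ℝ) :
    HasSum (fun k : ℕ => k * (t ^ k / k !)) (t * Real.exp t) := by
  rw [← hasSum_nat_add_iff' 1]
  simp only [Finset.range_one, Finset.sum_singleton, Nat.cast_zero, zero_mul, sub_zero]
  refine hasSum_of_eq ((hasSum_pow_div_factorial t).mul_left t) (fun k => ?_) rfl
  rw [Nat.factorial_succ]
  push_cast
  field_simp
  ring

theorem hasSum_sq_mul_pow_div_factorial (t : ℝ) :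
    HasSum (fun k : ℕ => (k : ℝ) ^ 2 * (t ^ k / k !)) ((t ^ 2 + t) * Real.exp t) := by
  rw [← hasSum_nat_add_iff' 1]
  simp only [Finset.range_one, Finset.sum_singleton, Nat.cast_zero, zero_mul, sub_zero, ne_eq,
    OfNat.ofNat_ne_zero, not_false_eq_true, zero_pow]
  have h := ((hasSum_mul_pow_div_factorial t).add (hasSum_pow_div_factorial t)).mul_left t
  refine hasSum_of_eq h (fun k => ?_) (by ring)
  rw [Nat.factorial_succ]
  push_cast
  field_simp
  ring

/-- The `ℓ¹` norm of the first difference of a Poisson law of parameter `t` is at most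
`1 / √t`. -/
theorem tsum_poisson_weight_le {t : ℝ} (ht : 0 < t) :
    Summable (fun k : ℕ => t ^ k / k ! * |k / t - 1|) ∧
      ∑' k : ℕ, t ^ k / k ! * |k / t - 1| ≤ Real.exp t / √t := by
  have hst : 0 < √t := Real.sqrt_pos.2 ht
  have hsq : √t ^ 2 = t := Real.sq_sqrt ht.le
  -- The majorant is `|x| ≤ (√t x² + 1/√t)/2`; since a Poisson variable of parameter `t` has
  -- variance `t`, both halves contribute equally.
  have hmaj : HasSum (fun k : ℕ => t ^ k / k ! * ((√t * (k / t - 1) ^ 2 + 1 / √t) / 2))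
      (Real.exp t / √t) := by
    have h := (((hasSum_sq_mul_pow_div_factorial t).mul_left (√t / t ^ 2 / 2)).sub
      ((hasSum_mul_pow_div_factorial t).mul_left (√t / t))).add
      ((hasSum_pow_div_factorial t).mul_left ((√t + 1 / √t) / 2))
    refine hasSum_of_eq h (fun k => ?_) ?_
    · field_simp
      ring
    · rw [← sub_eq_zero]
      field_simp
      rw [hsq]
      ring
  have hle (k : ℕ) : t ^ k / k ! * |k / t - 1| ≤
      t ^ k / k ! * ((√t * (k / t - 1) ^ 2 + 1 / √t) / 2) := by
    gcongr
    rw [← sq_abs (k / t - 1)]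
    have := sq_nonneg (√t * |k / t - 1| - 1)
    rw [← sub_nonneg]
    have h2 : (√t * |k / t - 1| ^ 2 + 1 / √t) / 2 - |k / t - 1| =
      (√t * |k / t - 1| - 1) ^ 2 / (2 * √t) := by
      field_simp
      ring
    rw [h2]
    positivity
  have hsum := Summable.of_nonneg_of_le (fun k => by positivity) hle hmaj.summable
  exact ⟨hsum, (hsum.tsum_le_tsum hle hmaj.summable).trans_eq hmaj.tsum_eq⟩

variable {A : Type*} [NormedRing A] [NormedAlgebra ℝ A] [CompleteSpace A]

theorem exp_smul_sub_one (S : A) (t : ℝ) :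
    exp (t • (S - 1)) = Real.exp (-t) • exp (t • S) := by
  let : NormedAlgebra ℚ A := NormedAlgebra.restrictScalars ℚ ℝ A
  have h1 : t • (S - 1) = algebraMap ℝ A (-t) + t • S := by
    rw [Algebra.algebraMap_eq_smul_one, smul_sub, neg_smul]; abel
  rw [h1, exp_add_of_commute (Algebra.commutes _ _), ← algebraMap_exp_comm,
    ← Algebra.smul_def, Real.exp_eq_exp_ℝ]

/-- Expanding `(S - 1) exp(tS)` in powers of `S` gives the coefficients `t^k/k! (k/t - 1)`, so
power-boundedness reduces the claim to the mean absolute deviation of a Poisson law. -/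
theorem norm_sub_one_mul_exp_le (S : A) (hS : ∀ n : ℕ, ‖S ^ n‖ ≤ 1) {t : ℝ} (ht : 0 < t) :
    ‖(S - 1) * exp (t • (S - 1))‖ ≤ 1 / √t := by
  have h0 : HasSum (fun k : ℕ => (t ^ k / k !) • S ^ k) (exp (t • S)) := by
    refine hasSum_of_eq (exp_series_hasSum_exp' (𝕂 := ℝ) (t • S)) (fun k => ?_) rfl
    rw [smul_pow, smul_smul, div_eq_inv_mul]
  have h1 : HasSum (fun k : ℕ => (t ^ k / k ! * (k / t)) • S ^ k) (S * exp (t • S)) := by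
    rw [← hasSum_nat_add_iff' 1]
    simp only [Finset.range_one, Finset.sum_singleton, Nat.cast_zero, zero_div, mul_zero,
      zero_smul, sub_zero]
    refine hasSum_of_eq (h0.mul_left S) (fun k => ?_) rfl
    rw [mul_smul_comm, ← pow_succ', Nat.factorial_succ]
    congr 1
    push_cast
    field_simp
    ring
  have h2 : HasSum (fun k : ℕ => (t ^ k / k ! * (k / t - 1)) • S ^ k)
      ((S - 1) * exp (t • S)) := by
    refine hasSum_of_eq (h1.sub h0) (fun k => ?_) ?_
    · rw [← sub_smul]; ring_nf
    · rw [sub_mul, one_mul]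
  obtain ⟨hs, hle⟩ := tsum_poisson_weight_le ht
  have h3 : ‖(S - 1) * exp (t • S)‖ ≤ Real.exp t / √t := by
    rw [← h2.tsum_eq]
    refine (tsum_of_norm_bounded hs.hasSum fun k => ?_).trans hle
    rw [norm_smul, norm_mul, Real.norm_eq_abs, Real.norm_eq_abs,
      abs_of_nonneg (by positivity : 0 ≤ t ^ k / k !)]
    exact mul_le_of_le_one_right (by positivity) (hS k)
  rw [exp_smul_sub_one, mul_smul_comm, norm_smul, Real.norm_eq_abs, Real.abs_exp]
  calc Real.exp (-t) * ‖(S - 1) * exp (t • S)‖ ≤ Real.exp (-t) * (Real.exp t / √t) := by gcongr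
    _ = 1 / √t := by rw [← mul_div_assoc, ← Real.exp_add]; simp

/-- Smoothing estimate: for a power-bounded element `S` of a Banach algebra,
`‖(S - 1)^s exp (λ (S - 1))‖ ≤ (s / λ)^{s/2}`. -/
theorem norm_sub_one_pow_mul_exp_le (S : A) (hS : ∀ n : ℕ, ‖S ^ n‖ ≤ 1) {lam : ℝ}
    (hlam : 0 < lam) {s : ℕ} (hs : 0 < s) :
    ‖(S - 1) ^ s * exp (lam • (S - 1))‖ ≤ (√s / √lam) ^ s := by
  let : NormedAlgebra ℚ A := NormedAlgebra.restrictScalars ℚ ℝ A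
  have hs' : (0 : ℝ) < s := Nat.cast_pos.2 hs
  -- Time `λ` is shared equally among the `s` factors `S - 1`.
  have h1 : lam • (S - 1) = s • ((lam / s) • (S - 1)) := by
    rw [← Nat.cast_smul_eq_nsmul ℝ, smul_smul, mul_div_cancel₀ _ hs'.ne']
  have hc : Commute (S - 1) (exp ((lam / s) • (S - 1))) :=
    ((Commute.refl (S - 1)).smul_right (lam / s)).exp_right
  rw [h1, exp_nsmul, ← hc.mul_pow]
  refine (norm_pow_le' _ hs).trans ?_
  gcongr
  refine (norm_sub_one_mul_exp_le S hS (div_pos hlam hs')).trans_eq ?_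
  rw [Real.sqrt_div hlam.le, one_div_div]

end Smoothing

/-! ### Translation and Fourier transform on `ℓ¹(ℤ)`. -/

section Sequences

open NormedSpace

/-- Absolutely summable real sequences indexed by `ℤ`. -/
abbrev L1 : Type := lp (fun _ : ℤ => ℝ) 1

theorem hasSum_norm_L1 (f : L1) : HasSum (fun k => |f k|) ‖f‖ := by
  simpa using lp.hasSum_norm (p := 1) (by simp) f

/-- The translation `(S f)(k) = f(k - 1)` of summable sequences. -/
noncomputable def shift : L1 →L[ℝ] L1 :=
  LinearMap.mkContinuous
    { toFun := fun f => ⟨fun k => f (k - 1), memℓp_gen (by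
        simpa [Function.comp_def] using
          (Equiv.subRight (1 : ℤ)).summable_iff.2 (hasSum_norm_L1 f).summable)⟩
      map_add' := fun f g => rfl
      map_smul' := fun c f => rfl } 1 fun f => by
    rw [one_mul]
    refine le_of_eq ((hasSum_norm_L1 _).unique ?_)
    exact (Equiv.subRight (1 : ℤ)).hasSum_iff.2 (hasSum_norm_L1 f)

theorem shift_apply (f : L1) (k : ℤ) : shift f k = f (k - 1) := rfl

theorem norm_shift_pow_le (n : ℕ) : ‖shift ^ n‖ ≤ 1 := by
  have h : ‖shift‖ ≤ 1 := LinearMap.mkContinuous_norm_le _ zero_le_one _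
  rcases n.eq_zero_or_pos with rfl | hn
  · exact ContinuousLinearMap.norm_id_le
  · exact (norm_pow_le' _ hn).trans (pow_le_one₀ (norm_nonneg _) h)

theorem summable_norm_fourier {a : ℤ → ℝ} (ha : Summable fun k => |a k|) (ξ : ℝ) :
    Summable fun k : ℤ => ‖(a k : ℂ) * Complex.exp (Complex.I * ξ * k)‖ := by
  simpa [norm_exp_I_mul_intCast] using ha

/-- Fourier transform of summable sequences at the frequency `ξ`. -/
noncomputable def fourierCLM (ξ : ℝ) : L1 →L[ℝ] ℂ :=
  LinearMap.mkContinuous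
    { toFun := fun f => ∑' k : ℤ, (f k : ℂ) * Complex.exp (Complex.I * ξ * k)
      map_add' := fun f g => by
        rw [← (summable_norm_fourier (hasSum_norm_L1 f).summable ξ).of_norm.tsum_add
          (summable_norm_fourier (hasSum_norm_L1 g).summable ξ).of_norm]
        refine tsum_congr fun k => ?_
        rw [lp.coeFn_add, Pi.add_apply, Complex.ofReal_add, add_mul]
      map_smul' := fun c f => by
        rw [RingHom.id_apply, Complex.real_smul, ← tsum_mul_left]
        refine tsum_congr fun k => ?_
        rw [lp.coeFn_smul, Pi.smul_apply, smul_eq_mul, Complex.ofReal_mul, mul_assoc] } 1 fun f => by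
    rw [one_mul]
    refine tsum_of_norm_bounded (hasSum_norm_L1 f) fun k => ?_
    rw [norm_mul, norm_exp_I_mul_intCast, mul_one, Complex.norm_real, Real.norm_eq_abs]

theorem fourierCLM_apply (ξ : ℝ) (f : L1) :
    fourierCLM ξ f = ∑' k : ℤ, (f k : ℂ) * Complex.exp (Complex.I * ξ * k) := rfl

theorem fourierCLM_shift (ξ : ℝ) (f : L1) :
    fourierCLM ξ (shift f) = Complex.exp (Complex.I * ξ) * fourierCLM ξ f := by
  rw [fourierCLM_apply, fourierCLM_apply, ← (Equiv.addRight (1 : ℤ)).tsum_eq, ← tsum_mul_left]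
  refine tsum_congr fun k => ?_
  rw [Equiv.coe_addRight, shift_apply, add_sub_cancel_right]
  push_cast
  rw [mul_add, mul_one, Complex.exp_add]
  ring

theorem fourierCLM_difference_pow (ξ : ℝ) (n : ℕ) (f : L1) :
    fourierCLM ξ (((shift - 1) ^ n) f) =
      (Complex.exp (Complex.I * ξ) - 1) ^ n * fourierCLM ξ f := by
  induction n generalizing f with
  | zero => simp
  | succ n ih =>
    rw [pow_succ, mul_apply_eq_comp, ih, sub_apply,
      one_apply_eq_self, map_sub, fourierCLM_shift]
    ring

theorem fourierCLM_exp (ξ lam : ℝ) (f : L1) :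
    fourierCLM ξ (exp (lam • (shift - 1)) f) =
      Complex.exp (lam * (Complex.exp (Complex.I * ξ) - 1)) * fourierCLM ξ f := by
  have h1 := exp_series_hasSum_exp' (𝕂 := ℝ) (lam • (shift - 1))
  have h2 := (fourierCLM ξ).hasSum ((ContinuousLinearMap.apply ℝ L1 f).hasSum h1)
  have h3 := (NormedSpace.expSeries_div_hasSum_exp
    ((lam : ℂ) * (Complex.exp (Complex.I * ξ) - 1))).mul_right (fourierCLM ξ f)
  rw [← Complex.exp_eq_exp_ℂ] at h3
  refine h2.unique (hasSum_of_eq h3 (fun n => ?_) rfl)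
  rw [ContinuousLinearMap.apply_apply, smul_pow, smul_smul, smul_apply,
    map_smul, fourierCLM_difference_pow, Complex.real_smul, mul_pow]
  push_cast
  ring

/-- The sequence with Fourier transform `(e^{iξ} - 1)^s e^{λ (e^{iξ} - 1)}`, that is, the iterated
difference of order `s` of the Poisson law of parameter `λ`. -/
noncomputable def poissonDifference (lam : ℝ) (s : ℕ) : L1 :=
  ((shift - 1) ^ s * exp (lam • (shift - 1))) (lp.single 1 0 1)

theorem fourierCLM_poissonDifference (lam ξ : ℝ) (s : ℕ) :
    fourierCLM ξ (poissonDifference lam s) = (Complex.exp (Complex.I * ξ) - 1) ^ s *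
      Complex.exp (lam * (Complex.exp (Complex.I * ξ) - 1)) := by
  have h : fourierCLM ξ (lp.single 1 0 1) = 1 := by
    rw [fourierCLM_apply, tsum_eq_single 0]
    · simp
    · intro k hk
      rw [lp.single_apply_ne _ _ _ hk]
      simp
  rw [poissonDifference, mul_apply_eq_comp, fourierCLM_difference_pow, fourierCLM_exp,
    h, mul_one]

theorem norm_poissonDifference_le {lam : ℝ} (hlam : 0 < lam) {s : ℕ} (hs : 0 < s) :
    ‖poissonDifference lam s‖ ≤ (√s / √lam) ^ s := by
  refine (ContinuousLinearMap.le_opNorm _ _).trans ?_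
  rw [lp.norm_single one_pos, norm_one, mul_one]
  exact norm_sub_one_pow_mul_exp_le shift norm_shift_pow_le hlam hs

end Sequences

/-! ### The approximation scheme and its error. -/

section Approximation

theorem fourierCLM_injective {f g : L1} (h : ∀ ξ, fourierCLM ξ f = fourierCLM ξ g) : f = g := by
  have h0 := eq_zero_of_fourier_series_eq_zero (fun k => (((f - g) k : ℝ) : ℂ))
    (by simpa only [Complex.norm_real, Real.norm_eq_abs] using
      (hasSum_norm_L1 (f - g)).summable) fun ξ => by
      rw [← fourierCLM_apply, map_sub, h, sub_self]
  refine sub_eq_zero.1 (lp.ext (funext fun k => ?_))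
  exact Complex.ofReal_eq_zero.1 (congrFun h0 k)

/-- The sequence of point masses of a signed measure on `ℤ`. -/
noncomputable def mass (ν : SignedMeasure ℤ) : L1 :=
  ⟨fun k => ν {k}, memℓp_gen (by simpa using summable_abs_mass ν)⟩

theorem mass_injective {μ ν : SignedMeasure ℤ} (h : mass μ = mass ν) : μ = ν :=
  signedMeasure_ext μ ν fun k => congrArg (fun f : L1 => f k) h

theorem exists_mass_eq (f : L1) : ∃ ν : SignedMeasure ℤ, mass ν = f := by
  obtain ⟨ν, hν⟩ := exists_signedMeasure f (hasSum_norm_L1 f).summable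
  exact ⟨ν, lp.ext (funext hν)⟩

theorem fourierTransform_eq (ν : SignedMeasure ℤ) (ξ : ℝ) :
    fourierTransform ν ξ = fourierCLM ξ (mass ν) := rfl

theorem dTV_eq_norm (μ ν : SignedMeasure ℤ) : dTV μ ν = 1 / 2 * ‖mass μ - mass ν‖ :=
  congrArg (1 / 2 * ·) (hasSum_norm_L1 (mass μ - mass ν)).tsum_eq

theorem mul_exp_neg_eq_iff (a c z : ℂ) (lam : ℝ) :
    a * Complex.exp (-(lam : ℂ) * z) = c ↔ a = c * Complex.exp (lam * z) := by
  rw [neg_mul, Complex.exp_neg, ← div_eq_mul_inv, div_eq_iff (Complex.exp_ne_zero _)]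

/-- The masses of the approximation scheme of order `r`. -/
noncomputable def scheme (lam : ℝ) (β : ℕ → ℝ) (r : ℕ) : L1 :=
  poissonDifference lam 0 + ∑ s ∈ Finset.Icc 2 r, β s • poissonDifference lam s

theorem fourierCLM_scheme (lam : ℝ) (β : ℕ → ℝ) (r : ℕ) (ξ : ℝ) :
    fourierCLM ξ (scheme lam β r) =
      (1 + ∑ s ∈ Finset.Icc 2 r, (β s : ℂ) * (Complex.exp (Complex.I * ξ) - 1) ^ s) *
        Complex.exp (lam * (Complex.exp (Complex.I * ξ) - 1)) := by
  simp only [scheme, map_add, map_sum, map_smul, fourierCLM_poissonDifference, Complex.real_smul,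
    pow_zero, add_mul, Finset.sum_mul, mul_assoc]

/-- Multiplying by `e^{λ(e^{iξ} - 1)}` and inverting the Fourier transform determines the masses,
which yields existence and uniqueness together. -/
theorem isApproximationScheme_iff (lam : ℝ) (b : ℕ → ℂ) (hb : ∀ s, 2 ≤ s → ((b s).re : ℂ) = b s)
    (r : ℕ) (ν : SignedMeasure ℤ) :
    IsApproximationScheme lam b r ν ↔ mass ν = scheme lam (fun s => (b s).re) r := by
  have hsum (ξ : ℝ) : ∑ s ∈ Finset.Icc 2 r, b s * (Complex.exp (Complex.I * ξ) - 1) ^ s =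
      ∑ s ∈ Finset.Icc 2 r, ((b s).re : ℂ) * (Complex.exp (Complex.I * ξ) - 1) ^ s :=
    Finset.sum_congr rfl fun s hs => by rw [hb s (Finset.mem_Icc.1 hs).1]
  simp only [IsApproximationScheme, mul_exp_neg_eq_iff, hsum, fourierTransform_eq,
    ← fourierCLM_scheme]
  exact ⟨fourierCLM_injective, fun h ξ => by rw [h]⟩

theorem norm_smul_poissonDifference_le {lam τ β : ℝ} (hlam : 0 < lam) {s : ℕ} (hs : 0 < s)
    (hβ : |β| ≤ (τ / √s) ^ s) : ‖β • poissonDifference lam s‖ ≤ (τ / √lam) ^ s := by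
  have hs' : 0 < √(s : ℝ) := Real.sqrt_pos.2 (Nat.cast_pos.2 hs)
  rw [norm_smul, Real.norm_eq_abs]
  calc |β| * ‖poissonDifference lam s‖ ≤ (τ / √s) ^ s * (√s / √lam) ^ s :=
        mul_le_mul hβ (norm_poissonDifference_le hlam hs) (norm_nonneg _)
          ((abs_nonneg _).trans hβ)
    _ = (τ / √lam) ^ s := by rw [← mul_pow, div_mul_div_cancel₀ hs'.ne']

/-- With order `r = m + 1`, the tail starts at `s = m + 2` and is dominated by a geometric series.
-/
theorem norm_mass_sub_scheme_le {Ω : Type*} [MeasurableSpace Ω] (P : Measure Ω)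
    [IsProbabilityMeasure P] (X : Ω → ℤ) (hX : Measurable X) {lam τ : ℝ} (hlam : 0 < lam)
    (hτ : 0 < τ) (hτlam : τ / √lam < 1) (b : ℕ → ℂ)
    (hψ : ∀ ξ : ℝ, HasSum
      (fun s : ℕ => b (s + 2) * (Complex.exp (Complex.I * ξ) - 1) ^ (s + 2))
      (residue P X lam ξ - 1))
    (hb : ∀ s : ℕ, 2 ≤ s → ‖b s‖ ≤ (τ / √(s : ℝ)) ^ s) (m : ℕ) :
    ‖mass (P.map X).toSignedMeasure - scheme lam (fun s => (b s).re) (m + 1)‖ ≤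
      (τ / √lam) ^ (m + 2) * (1 - τ / √lam)⁻¹ := by
  have hreal := coeff_real P X lam b hψ
  set q := τ / √lam with hq
  have hq0 : 0 ≤ q := by positivity
  have hbound (n : ℕ) :
      ‖(b (n + m + 2)).re • poissonDifference lam (n + m + 2)‖ ≤ q ^ (m + 2) * q ^ n := by
    refine (norm_smul_poissonDifference_le hlam (by omega)
      ((Complex.abs_re_le_norm _).trans (hb (n + m + 2) (by omega)))).trans_eq ?_
    rw [← hq, ← pow_add]
    congr 1
    omega
  have hgeom := (hasSum_geometric_of_lt_one hq0 hτlam).mul_left (q ^ (m + 2))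
  have hsum := (Summable.of_norm_bounded hgeom.summable hbound).hasSum
  -- The tail converges absolutely in `ℓ¹`, so this identity can be checked at each frequency, where
  -- it is the tail of the residue series times `e^{λ(e^{iξ} - 1)}`.
  have heq : mass (P.map X).toSignedMeasure - scheme lam (fun s => (b s).re) (m + 1) =
      ∑' n : ℕ, (b (n + m + 2)).re • poissonDifference lam (n + m + 2) := by
    refine fourierCLM_injective fun ξ => ?_
    refine HasSum.unique ?_ ((fourierCLM ξ).hasSum hsum)
    have hres : fourierCLM ξ (mass (P.map X).toSignedMeasure) = residue P X lam ξ *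
        Complex.exp (lam * (Complex.exp (Complex.I * ξ) - 1)) := by
      rw [← fourierTransform_eq, ← integral_exp_eq_fourierTransform P X hX ξ,
        ← mul_exp_neg_eq_iff]
      rfl
    have htail := ((hasSum_nat_add_iff' m).2 (hψ ξ)).mul_right
      (Complex.exp (lam * (Complex.exp (Complex.I * ξ) - 1)))
    refine hasSum_of_eq htail (fun n => ?_) ?_
    · rw [map_smul, fourierCLM_poissonDifference, Complex.real_smul,
        hreal (n + m + 2) (by omega), mul_assoc]
    · have hIcc : ∑ s ∈ Finset.Icc 2 (m + 1),
          ((b s).re : ℂ) * (Complex.exp (Complex.I * ξ) - 1) ^ s =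
          ∑ i ∈ Finset.range m, b (i + 2) * (Complex.exp (Complex.I * ξ) - 1) ^ (i + 2) := by
        rw [← Finset.Ico_add_one_right_eq_Icc, Finset.range_eq_Ico,
          Finset.sum_Ico_add' (fun s => b s * (Complex.exp (Complex.I * ξ) - 1) ^ s) 0 m 2]
        refine Finset.sum_congr (by congr 1) fun s hs => ?_
        rw [hreal s (by simp only [Finset.mem_Ico] at hs; omega)]
      rw [map_sub, hres, fourierCLM_scheme, hIcc]
      ring
  rw [heq]
  exact tsum_of_norm_bounded hgeom hbound

end Approximation

end ModPoisson

theorem theoremA {Ω : Type*} [MeasurableSpace Ω] (P : Measure Ω) [IsProbabilityMeasure P]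
    (X : Ω → ℤ) (hX : Measurable X)
    (lam τ : ℝ) (hlam : 0 < lam) (hτ : 0 < τ)
    (b : ℕ → ℂ)
    (hψ : ∀ ξ : ℝ, HasSum
      (fun s : ℕ => b (s + 2) * (Complex.exp (Complex.I * ξ) - 1) ^ (s + 2))
      (ModPoisson.residue P X lam ξ - 1))
    (hb : ∀ s : ℕ, 2 ≤ s → ‖b s‖ ≤ (τ / √(s : ℝ)) ^ s)
    (hε : 4 * τ / √lam < 1)
    (r : ℕ) (hr : 1 ≤ r) :
    (∃! ν : SignedMeasure ℤ, ModPoisson.IsApproximationScheme lam b r ν) ∧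
    ∀ ν : SignedMeasure ℤ, ModPoisson.IsApproximationScheme lam b r ν →
      ModPoisson.dTV (P.map X).toSignedMeasure ν ≤ 570 * (4 * τ / √lam) ^ (r + 1) := by
  simp only [ModPoisson.isApproximationScheme_iff lam b (ModPoisson.coeff_real P X lam b hψ)]
  constructor
  · obtain ⟨ν, hν⟩ := ModPoisson.exists_mass_eq (ModPoisson.scheme lam (fun s => (b s).re) r)
    exact ⟨ν, hν, fun ν' hν' => ModPoisson.mass_injective (hν'.trans hν.symm)⟩
  · intro ν hν
    obtain ⟨m, rfl⟩ := Nat.exists_eq_add_of_le' hr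
    have hq0 : 0 ≤ τ / √lam := by positivity
    rw [mul_div_assoc] at hε ⊢
    have hq : τ / √lam < 1 / 4 := by linarith
    have hnorm := ModPoisson.norm_mass_sub_scheme_le P X hX hlam hτ (by linarith) b hψ hb m
    -- The crude bound `2` cancels the `1/2` of `dTV`; the argument thus gives constant `1`, well
    -- below `570`.
    have hinv : (1 - τ / √lam)⁻¹ ≤ 2 := by
      rw [inv_le_comm₀ (by linarith) two_pos]
      linarith
    rw [ModPoisson.dTV_eq_norm, hν]
    have hpow : (τ / √lam) ^ (m + 2) ≤ (4 * (τ / √lam)) ^ (m + 2) := by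
      gcongr
      linarith
    have hpos : 0 ≤ (τ / √lam) ^ (m + 2) := by positivity
    have hmul := mul_le_mul_of_nonneg_left hinv hpos
    linarith
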